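/- Let $K$ be a positive definite $n\times n$ matrix (real symmetric or complex Hermitian) with eigenvalues, listed with multiplicity in increasing order, $\lambda_1\le\lambda_2\le\dots\le\lambda_n$. For $S\subseteq\{1,\dots,n\}$ let $|K(S)|$ denote the determinant of the principal submatrix of $K$ with rows and columns indexed by $S$, with $|K(\emptyset)|=1$. Let $k,h,p,\ell$ be integers with $1\le k\le h\le p\le n$ and $0\le\ell\le n-p$, and put $P^{\mathrm c}=\{p+1,\dots,n\}$ and $Q_\ell=\{p+1,\dots,p+\ell\}$ (so $Q_0=\emptyset$). Then $$\prod_{i=1}^{h+\ell}\lambda_i\;\le\;|K(Q_\ell)|\left(\prod_{\substack{S\subseteq\{1,\dots,h\}\\ |S|=k}}\frac{|K(S\cup P^{\mathrm c})|}{|K(P^{\mathrm c})|}\right)^{1/\binom{h-1}{k-1}}.$$ -/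

import Mathlib

open scoped ComplexOrder

/-- The interval `[a : b]` of (one-based) indices of an `n × n` matrix: the `i`-th row or column,
`i = 1, …, n`, is the element of `Fin n` with value `i - 1`. -/
def idx (n a b : ℕ) : Finset (Fin n) :=
  {i | a ≤ i.val + 1 ∧ i.val + 1 ≤ b}

/-- The determinant `|K(S)|` of the principal submatrix of `K` with rows and columns in `S`
(equal to `1` for `S = ∅`). It is used for Hermitian `K` only; the determinant is then a real
number, and `RCLike.re` views it as an element of `ℝ`. -/
noncomputable def principalMinor {𝕜 : Type*} [RCLike 𝕜] {n : ℕ} (K : Matrix (Fin n) (Fin n) 𝕜)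
    (S : Finset (Fin n)) : ℝ :=
  RCLike.re (K.submatrix (fun i : S => i.val) (fun i : S => i.val)).det

/-- The eigenvalues of a Hermitian matrix, with multiplicity, in increasing order: the smallest
eigenvalue has index `0`. (Mathlib's `eigenvalues₀` lists them in decreasing order.) -/
noncomputable def incEigenvalues {𝕜 : Type*} [RCLike 𝕜] {n : ℕ} {K : Matrix (Fin n) (Fin n) 𝕜}
    (hK : K.IsHermitian) (i : Fin n) : ℝ :=
  hK.eigenvalues₀ (Fin.cast (Fintype.card_fin n).symm i.rev)

/-! Write H, P, Q for {1,…,h}, Pᶜ, Q_ℓ of the informal statement. The ratio G(S) = |K(S ∪ P)| /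
|K(P)| is log-submodular, so Han's inequality for log G bounds G(H) by the product over k-subsets
raised to 1 / C(h-1, k-1). It remains to bound |K(Q)| G(H) from below by the eigenvalue product.

Fischer's inequality gives |K(P)| ≤ |K(P \ Q)| |K(Q)|, so it suffices that |K(H ∪ P)| / |K(P \ Q)|
is at least the product of the h+ℓ smallest eigenvalues. This ratio is the determinant of a Schur
complement on H ∪ Q, of the form A* K A with A containing an identity block. Cauchy–Binet yields
both det(A* K A) ≥ λ₁⋯λ_{h+ℓ} det(A* A) and det(A* A) ≥ 1. -/

/-! ### Cauchy–Binet expansions -/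

/-- The **Cauchy–Binet formula**, with the sum running over all maps instead of all subsets. -/
theorem Matrix.factorial_mul_det_mul {R m n : Type*} [CommRing R] [Fintype m] [DecidableEq m]
    [Fintype n] (M : Matrix m n R) (N : Matrix n m R) :
    ((Fintype.card m).factorial : R) * (M * N).det =
      ∑ f : m → n, (M.submatrix id f).det * (N.submatrix f id).det := by
  have expand : (M * N).det = ∑ f : m → n, (∏ i, N (f i) i) * (M.submatrix id f).det := by
    simp only [Matrix.det_apply', Matrix.mul_apply, Finset.prod_univ_sum, Finset.mul_sum,
      Fintype.piFinset_univ]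
    rw [Finset.sum_comm]
    refine Finset.sum_congr rfl fun f _ => Finset.sum_congr rfl fun σ _ => ?_
    simp only [Finset.prod_mul_distrib, Matrix.submatrix_apply, id]
    ring
  -- Replacing `f` by `f ∘ σ` moves the sign onto the entries of `N`; summing over `σ` then builds
  -- the minor of `N` and produces the factorial.
  have permuted (σ : Equiv.Perm m) : (M * N).det =
      ∑ f : m → n, (M.submatrix id f).det * (σ.sign * ∏ i, N (f (σ i)) i) := by
    rw [expand, ← (Equiv.arrowCongr σ (Equiv.refl n)).symm.sum_comp]
    refine Finset.sum_congr rfl fun f _ => ?_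
    have : M.submatrix id ((Equiv.arrowCongr σ (Equiv.refl n)).symm f) =
        (M.submatrix id f).submatrix id σ := by
      ext i j; simp [Equiv.arrowCongr]
    rw [this, Matrix.det_permute']
    simp [Equiv.arrowCongr]
    ring
  calc ((Fintype.card m).factorial : R) * (M * N).det = ∑ _σ : Equiv.Perm m, (M * N).det := by
        simp [Fintype.card_perm]
    _ = ∑ σ : Equiv.Perm m, ∑ f : m → n,
          (M.submatrix id f).det * (σ.sign * ∏ i, N (f (σ i)) i) :=
        Finset.sum_congr rfl fun σ _ => permuted σ
    _ = _ := by
        rw [Finset.sum_comm]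
        simp only [← Finset.mul_sum, Matrix.det_apply', Matrix.submatrix_apply, id]

theorem Matrix.factorial_mul_det_conjTranspose_mul_diagonal_mul {𝕜 m n : Type*} [RCLike 𝕜]
    [Fintype m] [DecidableEq m] [Fintype n] [DecidableEq n] (B : Matrix n m 𝕜) (d : n → ℝ) :
    ((Fintype.card m).factorial : 𝕜) *
        (B.conjTranspose * Matrix.diagonal (fun i => (d i : 𝕜)) * B).det =
      ((∑ f : m → n, (∏ i, d (f i)) * ‖(B.submatrix f id).det‖ ^ 2 : ℝ) : 𝕜) := by
  rw [Matrix.factorial_mul_det_mul]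
  push_cast
  refine Finset.sum_congr rfl fun f _ => ?_
  have : (B.conjTranspose * Matrix.diagonal (fun i => (d i : 𝕜))).submatrix id f =
      (B.submatrix f id).conjTranspose * Matrix.diagonal (fun i => (d (f i) : 𝕜)) := by
    ext i j; simp [Matrix.mul_diagonal]
  rw [this, Matrix.det_mul, Matrix.det_conjTranspose, Matrix.det_diagonal, ← RCLike.conj_mul]
  simp only [starRingEnd_apply]
  ring

/-! ### Eigenvalue bounds for compressions -/

theorem prod_idx_le_prod_of_monotone {n : ℕ} {f : Fin n → ℝ} (hf : Monotone f)
    (hf₀ : ∀ i, 0 ≤ f i) (s : Finset (Fin n)) :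
    ∏ i ∈ idx n 1 s.card, f i ≤ ∏ i ∈ s, f i := by
  have hs : s.card ≤ n := by simpa using s.card_le_univ
  have low : ∏ i ∈ idx n 1 s.card, f i = ∏ j : Fin s.card, f (Fin.castLE hs j) := by
    rw [← Finset.prod_image (s := Finset.univ) (g := Fin.castLE hs) (f := f)
      (Fin.castLE_injective hs).injOn]
    congr 1
    ext i
    simp only [idx, Finset.mem_filter, Finset.mem_univ, true_and, Finset.mem_image]
    constructor
    · intro h
      exact ⟨⟨i, by omega⟩, rfl⟩
    · rintro ⟨j, rfl⟩
      have := j.2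
      simp only [Fin.val_castLE]
      omega
  have high : ∏ i ∈ s, f i = ∏ j : Fin s.card, f (s.orderEmbOfFin rfl j) := by
    conv_lhs => rw [← Finset.image_orderEmbOfFin_univ s rfl]
    rw [Finset.prod_image (s.orderEmbOfFin rfl).injective.injOn]
  rw [low, high]
  refine Finset.prod_le_prod (fun _ _ => hf₀ _) fun j _ => hf ?_
  -- The element of rank m (from 0) in `s` is at least m.
  have key : ∀ (m : ℕ) (hm : m < s.card), m ≤ (s.orderEmbOfFin rfl ⟨m, hm⟩).val := by
    intro m
    induction m with
    | zero => simp
    | succ m ih =>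
      intro hm
      have h1 := ih (by omega)
      have h2 : s.orderEmbOfFin rfl ⟨m, by omega⟩ < s.orderEmbOfFin rfl ⟨m + 1, hm⟩ :=
        (s.orderEmbOfFin rfl).strictMono (by simp [Fin.lt_def])
      rw [Fin.lt_def] at h2
      omega
  exact key j.1 j.2

theorem Matrix.PosDef.incEigenvalues_nonneg {𝕜 : Type*} [RCLike 𝕜] {n : ℕ}
    {K : Matrix (Fin n) (Fin n) 𝕜} (hK : K.PosDef) (i : Fin n) :
    0 ≤ incEigenvalues hK.isHermitian i := by
  have := hK.eigenvalues_pos (Fintype.equivOfCardEq (Fintype.card_fin (Fintype.card (Fin n)))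
    (Fin.cast (Fintype.card_fin n).symm i.rev))
  simpa [incEigenvalues, Matrix.IsHermitian.eigenvalues] using this.le

theorem prod_incEigenvalues_le_prod_eigenvalues {𝕜 ι : Type*} [RCLike 𝕜] [Fintype ι] {n : ℕ}
    {K : Matrix (Fin n) (Fin n) 𝕜} (hK : K.PosDef) {f : ι → Fin n} (hf : Function.Injective f) :
    ∏ i ∈ idx n 1 (Fintype.card ι), incEigenvalues hK.isHermitian i ≤
      ∏ i, hK.isHermitian.eigenvalues (f i) := by
  set e : Fin n ≃ Fin n := (Fintype.equivOfCardEq (Fintype.card_fin (Fintype.card (Fin n)))).symm.trans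
    ((finCongr (Fintype.card_fin n)).trans Fin.revPerm) with he
  have hval (i : Fin n) : hK.isHermitian.eigenvalues i = incEigenvalues hK.isHermitian (e i) := by
    simp [he, incEigenvalues, Matrix.IsHermitian.eigenvalues]
  have hmono : Monotone (incEigenvalues hK.isHermitian) := fun i j hij =>
    hK.isHermitian.eigenvalues₀_antitone (by simpa [Fin.le_def] using Fin.rev_le_rev.2 hij)
  classical
  have hinj : Function.Injective fun i => e (f i) := e.injective.comp hf
  have := prod_idx_le_prod_of_monotone hmono hK.incEigenvalues_nonneg (Finset.univ.image fun i => e (f i))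
  rw [Finset.card_image_of_injective _ hinj, Finset.prod_image hinj.injOn] at this
  simpa [hval] using this

/-- In an eigenbasis both determinants expand over the same squared minors, weighted by eigenvalue
products on one side and by 1 on the other. Only injective `f` contribute, and these pick distinct
eigenvalues. -/
theorem Matrix.PosDef.prod_incEigenvalues_mul_det_le {𝕜 m : Type*} [RCLike 𝕜] [Fintype m]
    [DecidableEq m] {n : ℕ} {K : Matrix (Fin n) (Fin n) 𝕜} (hK : K.PosDef)
    (A : Matrix (Fin n) m 𝕜) :
    (∏ i ∈ idx n 1 (Fintype.card m), incEigenvalues hK.isHermitian i) *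
        RCLike.re (A.conjTranspose * A).det ≤ RCLike.re (A.conjTranspose * K * A).det := by
  set U : Matrix (Fin n) (Fin n) 𝕜 := hK.isHermitian.eigenvectorUnitary.1
  set d := hK.isHermitian.eigenvalues
  set B := U.conjTranspose * A with hB
  have hU : U * U.conjTranspose = 1 := Unitary.coe_mul_star_self hK.isHermitian.eigenvectorUnitary
  have hKU : K = U * Matrix.diagonal (fun i => (d i : 𝕜)) * U.conjTranspose := by
    have := hK.isHermitian.spectral_theorem
    rw [Unitary.conjStarAlgAut_apply] at this
    exact this
  have h1 : A.conjTranspose * K * A =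
      B.conjTranspose * Matrix.diagonal (fun i => (d i : 𝕜)) * B := by
    rw [hKU, hB]
    simp [Matrix.mul_assoc]
  have h2 : A.conjTranspose * A =
      B.conjTranspose * (Matrix.diagonal fun _ => ((1 : ℝ) : 𝕜) : Matrix (Fin n) (Fin n) 𝕜) * B := by
    rw [hB, Matrix.conjTranspose_mul, Matrix.conjTranspose_conjTranspose]
    simp only [RCLike.ofReal_one, Matrix.diagonal_one, Matrix.mul_one]
    rw [Matrix.mul_assoc, ← Matrix.mul_assoc U, hU, Matrix.one_mul]
  have e1 := congrArg RCLike.re (factorial_mul_det_conjTranspose_mul_diagonal_mul B d)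
  have e2 := congrArg RCLike.re (factorial_mul_det_conjTranspose_mul_diagonal_mul B fun _ => 1)
  rw [← h1, RCLike.ofReal_re, ← RCLike.ofReal_natCast, RCLike.re_ofReal_mul] at e1
  rw [← h2, RCLike.ofReal_re, ← RCLike.ofReal_natCast, RCLike.re_ofReal_mul] at e2
  have hpos : (0 : ℝ) < (Fintype.card m).factorial := by exact_mod_cast Nat.factorial_pos _
  refine le_of_mul_le_mul_left ?_ hpos
  rw [mul_left_comm, e1, e2, Finset.mul_sum]
  refine Finset.sum_le_sum fun f _ => ?_
  by_cases hf : Function.Injective f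
  · simp only [Finset.prod_const_one, one_mul]
    exact mul_le_mul_of_nonneg_right (prod_incEigenvalues_le_prod_eigenvalues hK hf) (sq_nonneg _)
  · obtain ⟨i, j, hij, hne⟩ : ∃ i j, f i = f j ∧ i ≠ j := by
      simpa [Function.Injective] using hf
    have : (B.submatrix f id).det = 0 :=
      Matrix.det_zero_of_row_eq hne (by ext; simp [hij])
    simp [this]

/-- In the sum of squared minors, the m! maps `e ∘ σ` already contribute 1 each. -/
theorem Matrix.one_le_re_det_conjTranspose_mul_self {𝕜 m n : Type*} [RCLike 𝕜] [Fintype m]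
    [DecidableEq m] [Fintype n] [DecidableEq n] (A : Matrix n m 𝕜) {e : m → n}
    (he : Function.Injective e) (hA : A.submatrix e id = 1) :
    1 ≤ RCLike.re (A.conjTranspose * A).det := by
  have e2 := congrArg RCLike.re (factorial_mul_det_conjTranspose_mul_diagonal_mul A fun _ => 1)
  rw [RCLike.ofReal_re, ← RCLike.ofReal_natCast, RCLike.re_ofReal_mul] at e2
  simp only [RCLike.ofReal_one, Matrix.diagonal_one, Matrix.mul_one, Finset.prod_const_one,
    one_mul] at e2
  have hpos : (0 : ℝ) < (Fintype.card m).factorial := by exact_mod_cast Nat.factorial_pos _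
  refine le_of_mul_le_mul_left ?_ hpos
  rw [e2]
  have hinj : Function.Injective fun σ : Equiv.Perm m => e ∘ σ := fun σ τ h =>
    Equiv.ext fun i => he (congrFun h i)
  calc ((Fintype.card m).factorial : ℝ) * 1
      = ∑ σ : Equiv.Perm m, ‖(A.submatrix (e ∘ σ) id).det‖ ^ 2 := by
        rw [Finset.sum_congr rfl (g := fun _ => (1 : ℝ))]
        · simp [Fintype.card_perm]
        · intro σ _
          have : A.submatrix (e ∘ σ) id = (A.submatrix e id).submatrix σ id := rfl
          rw [this, Matrix.det_permute, hA, Matrix.det_one, mul_one]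
          rcases Int.units_eq_one_or (Equiv.Perm.sign σ) with h | h <;> simp [h]
    _ = ∑ f ∈ Finset.univ.image fun σ : Equiv.Perm m => e ∘ σ, ‖(A.submatrix f id).det‖ ^ 2 :=
        (Finset.sum_image (f := fun f => ‖(A.submatrix f id).det‖ ^ 2) hinj.injOn).symm
    _ ≤ _ := Finset.sum_le_univ_sum_of_nonneg fun _ => sq_nonneg _

/-! ### Submodular set functions -/

section SetFunction

variable {α : Type*} [DecidableEq α]

/-- Local submodularity of a positive set function implies that its ratios under insertion of
an element are antitone. -/
theorem insert_mul_le_mul_insert_of_local {F : Finset α → ℝ} (hF : ∀ S, 0 < F S)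
    (hloc : ∀ S i j, i ∉ S → j ∉ S → i ≠ j →
      F (insert i (insert j S)) * F S ≤ F (insert i S) * F (insert j S))
    {S T : Finset α} (hST : S ⊆ T) {i : α} (hi : i ∉ T) :
    F (insert i T) * F S ≤ F (insert i S) * F T := by
  induction T using Finset.strongInduction with
  | H T ih =>
    rcases hST.eq_or_ssubset with rfl | h
    · exact le_rfl
    obtain ⟨j, hjT, hjS⟩ := Finset.exists_of_ssubset h
    have hT : insert j (T.erase j) = T := Finset.insert_erase hjT
    have hi' : i ∉ T.erase j := fun h => hi (Finset.mem_of_mem_erase h)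
    have h1 := ih (T.erase j) (Finset.erase_ssubset hjT)
      (fun x hx => Finset.mem_erase.2 ⟨fun h => hjS (h ▸ hx), hST hx⟩) hi'
    have h2 := hloc (T.erase j) i j hi' (Finset.notMem_erase j T) (fun h => hi (h ▸ hjT))
    rw [hT] at h2
    refine le_of_mul_le_mul_left ?_ (hF (T.erase j))
    calc F (T.erase j) * (F (insert i T) * F S)
        = F (insert i T) * F (T.erase j) * F S := by ring
      _ ≤ F (insert i (T.erase j)) * F T * F S := mul_le_mul_of_nonneg_right h2 (hF S).le
      _ = F (insert i (T.erase j)) * F S * F T := by ring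
      _ ≤ F (insert i S) * F (T.erase j) * F T := mul_le_mul_of_nonneg_right h1 (hF T).le
      _ = _ := by ring

theorem union_mul_empty_le_of_antitone_ratio {F : Finset α → ℝ} (hF : ∀ S, 0 < F S)
    (hanti : ∀ S T i, S ⊆ T → i ∉ T → F (insert i T) * F S ≤ F (insert i S) * F T)
    {S T : Finset α} (hST : Disjoint S T) : F (S ∪ T) * F ∅ ≤ F S * F T := by
  induction T using Finset.induction with
  | empty => simp
  | insert a T ha ih =>
    rw [Finset.disjoint_insert_right] at hST
    have h1 := hanti T (S ∪ T) a Finset.subset_union_right (by simp [hST.1, ha])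
    have h2 := ih hST.2
    rw [Finset.union_insert]
    refine le_of_mul_le_mul_left ?_ (hF T)
    calc F T * (F (insert a (S ∪ T)) * F ∅) = F (insert a (S ∪ T)) * F T * F ∅ := by ring
      _ ≤ F (insert a T) * F (S ∪ T) * F ∅ := mul_le_mul_of_nonneg_right h1 (hF _).le
      _ = F (insert a T) * (F (S ∪ T) * F ∅) := by ring
      _ ≤ F (insert a T) * (F S * F T) := mul_le_mul_of_nonneg_left h2 (hF _).le
      _ = _ := by ring

/-- **Han's inequality** for a submodular set function on the subsets of `H`. -/
theorem choose_mul_le_sum_powersetCard {g : Finset α → ℝ} (hg : g ∅ = 0) (H : Finset α)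
    (hanti : ∀ S T i, S ⊆ T → insert i T ⊆ H → i ∉ T → g (insert i T) + g S ≤ g (insert i S) + g T)
    (k : ℕ) :
    ((H.card - 1).choose k : ℝ) * g H ≤ ∑ S ∈ H.powersetCard (k + 1), g S := by
  induction H using Finset.induction generalizing k with
  | empty =>
    have : (∅ : Finset α).powersetCard (k + 1) = ∅ := Finset.powersetCard_eq_empty.2 (by simp)
    simp [hg, this]
  | insert a H ha ih =>
    have ih := ih fun S T i h1 h2 => hanti S T i h1 (h2.trans (Finset.subset_insert _ _))
    have step : ∑ S ∈ (insert a H).powersetCard (k + 1), g S =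
        ∑ S ∈ H.powersetCard (k + 1), g S + ∑ S ∈ H.powersetCard k, g (insert a S) := by
      rw [Finset.powersetCard_succ_insert ha, Finset.sum_union, Finset.sum_image]
      · intro S hS T hT h
        have hS' : a ∉ S := fun h => ha ((Finset.mem_powersetCard.1 hS).1 h)
        have hT' : a ∉ T := fun h => ha ((Finset.mem_powersetCard.1 hT).1 h)
        rw [← Finset.erase_insert hS', ← Finset.erase_insert hT']
        exact congrArg (fun X => Finset.erase X a) h
      · rw [Finset.disjoint_left]
        intro S hS hS'
        obtain ⟨T, -, rfl⟩ := Finset.mem_image.1 hS'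
        exact ha ((Finset.mem_powersetCard.1 hS).1 (Finset.mem_insert_self a T))
    -- The increment from adding `a` is smallest at the largest set `H`.
    have lower : (H.card.choose k : ℝ) * (g (insert a H) - g H) + ∑ S ∈ H.powersetCard k, g S ≤
        ∑ S ∈ H.powersetCard k, g (insert a S) := by
      rw [← Finset.card_powersetCard k H, ← nsmul_eq_mul, ← Finset.sum_const,
        ← Finset.sum_add_distrib]
      refine Finset.sum_le_sum fun S hS => ?_
      have := hanti S H a (Finset.mem_powersetCard.1 hS).1 le_rfl ha
      linarith
    rw [step, Finset.card_insert_of_notMem ha, Nat.add_sub_cancel]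
    rcases k with _ | k
    · have h0 := ih 0
      simp [hg] at lower h0 ⊢
      linarith
    · have h1 := ih (k + 1)
      have h2 := ih k
      -- Pascal's rule below needs `H` nonempty, as `H.card - 1` is truncated.
      rcases H.eq_empty_or_nonempty with rfl | hne
      · have (m : ℕ) : (∅ : Finset α).powersetCard (m + 1) = ∅ :=
          Finset.powersetCard_eq_empty.2 (by simp)
        simp [this]
      · have hc : (H.card.choose (k + 1) : ℝ) =
            (H.card - 1).choose k + (H.card - 1).choose (k + 1) := by
          have : H.card = H.card - 1 + 1 := by have := hne.card_pos; omega
          rw [this, Nat.choose_succ_succ]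
          push_cast
          rfl
        have : (H.card.choose (k + 1) : ℝ) * g H =
            (H.card - 1).choose k * g H + (H.card - 1).choose (k + 1) * g H := by rw [hc]; ring
        linarith

/-- The multiplicative form of Han's inequality. -/
theorem le_prod_powersetCard_rpow_of_antitone_ratio {G : Finset α → ℝ} (hG : ∀ S, 0 < G S)
    (hG₁ : G ∅ = 1) (H : Finset α)
    (hanti : ∀ S T i, S ⊆ T → insert i T ⊆ H → i ∉ T → G (insert i T) * G S ≤ G (insert i S) * G T)
    {k : ℕ} (hk : 1 ≤ k) (hkH : k ≤ H.card) :
    G H ≤ (∏ S ∈ H.powersetCard k, G S) ^ (1 / ((H.card - 1).choose (k - 1) : ℝ)) := by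
  have hprod : 0 < ∏ S ∈ H.powersetCard k, G S := Finset.prod_pos fun S _ => hG S
  have hc : (0 : ℝ) < ((H.card - 1).choose (k - 1) : ℝ) := by
    exact_mod_cast Nat.choose_pos (by omega)
  have key := choose_mul_le_sum_powersetCard (g := fun S => Real.log (G S)) (by simp [hG₁]) H
    (fun S T i h1 h2 h3 => by
      rw [← Real.log_mul (hG _).ne' (hG _).ne', ← Real.log_mul (hG _).ne' (hG _).ne']
      exact Real.log_le_log (mul_pos (hG _) (hG _)) (hanti S T i h1 h2 h3)) (k - 1)
  rw [Nat.sub_add_cancel hk, ← Real.log_prod fun S _ => (hG S).ne'] at key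
  rw [← Real.log_le_log_iff (hG H) (Real.rpow_pos_of_pos hprod _), Real.log_rpow hprod,
    one_div, ← div_eq_inv_mul, le_div_iff₀ hc, mul_comm]
  exact key

end SetFunction

/-! ### Principal minors and Schur complements -/

section PrincipalMinor

variable {𝕜 : Type*} [RCLike 𝕜] {n : ℕ} {K : Matrix (Fin n) (Fin n) 𝕜}

theorem Matrix.PosDef.ofReal_principalMinor (hK : K.PosDef) (S : Finset (Fin n)) :
    ((principalMinor K S : ℝ) : 𝕜) = (K.submatrix (fun i : S => i.val) (fun i : S => i.val)).det :=
  RCLike.conj_eq_iff_re.1 (RCLike.conj_eq_iff_im.2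
    (RCLike.pos_iff.1 (hK.submatrix Subtype.val_injective).det_pos).2)

theorem Matrix.PosDef.principalMinor_pos (hK : K.PosDef) (S : Finset (Fin n)) :
    0 < principalMinor K S :=
  (RCLike.pos_iff.1 (hK.submatrix Subtype.val_injective).det_pos).1

theorem principalMinor_empty (K : Matrix (Fin n) (Fin n) 𝕜) : principalMinor K ∅ = 1 := by
  simp [principalMinor]

theorem principalMinor_eq_re_det_submatrix {ι : Type*} [Fintype ι] [DecidableEq ι]
    (K : Matrix (Fin n) (Fin n) 𝕜) {e : ι → Fin n} (he : Function.Injective e)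
    {S : Finset (Fin n)} (hS : ∀ x, x ∈ S ↔ ∃ i, e i = x) :
    principalMinor K S = RCLike.re (K.submatrix e e).det := by
  let φ : ι ≃ S := Equiv.ofBijective (fun i => ⟨e i, (hS _).2 ⟨i, rfl⟩⟩)
    ⟨fun i j h => he (congrArg Subtype.val h), fun ⟨x, hx⟩ => by
      obtain ⟨i, rfl⟩ := (hS x).1 hx
      exact ⟨i, rfl⟩⟩
  rw [principalMinor, ← Matrix.det_submatrix_equiv_self φ]
  rfl

/-- The Schur complement of the block of `K` indexed by `R`, as a matrix with all the rows and
columns of `K` (those indexed by `R` vanish). -/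
noncomputable def schurComplement (K : Matrix (Fin n) (Fin n) 𝕜) (R : Finset (Fin n)) :
    Matrix (Fin n) (Fin n) 𝕜 :=
  K - K.submatrix id (fun i : R => i.val) *
    (K.submatrix (fun i : R => i.val) (fun i : R => i.val))⁻¹ *
      K.submatrix (fun i : R => i.val) id

theorem Matrix.IsHermitian.schurComplement (hK : K.IsHermitian) (R : Finset (Fin n)) :
    (schurComplement K R).IsHermitian := by
  have h : (K.submatrix (fun i : R => i.val) (fun i : R => i.val)).IsHermitian := hK.submatrix _
  simp only [_root_.schurComplement, Matrix.IsHermitian, Matrix.conjTranspose_sub,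
    Matrix.conjTranspose_mul, Matrix.conjTranspose_submatrix, hK.eq, h.inv.eq, Matrix.mul_assoc]

theorem Matrix.PosDef.principalMinor_union_eq (hK : K.PosDef) (R : Finset (Fin n))
    {ι : Type*} [Fintype ι] [DecidableEq ι] {e : ι → Fin n} (he : Function.Injective e)
    {S : Finset (Fin n)} (hS : ∀ x, x ∈ S ↔ x ∈ R ∨ ∃ i, e i = x) (hR : ∀ i, e i ∉ R) :
    principalMinor K S =
      principalMinor K R * RCLike.re ((schurComplement K R).submatrix e e).det := by
  set A := K.submatrix (fun i : R => i.val) (fun i : R => i.val) with hA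
  have hunit : IsUnit A := (hK.submatrix Subtype.val_injective).isUnit
  have := hunit.invertible
  have hinj : Function.Injective (Sum.elim (fun i : R => i.val) e) :=
    Subtype.val_injective.sumElim he fun a b h => hR b (h ▸ a.2)
  have hblocks : K.submatrix (Sum.elim (fun i : R => i.val) e) (Sum.elim (fun i : R => i.val) e) =
      Matrix.fromBlocks A (K.submatrix (fun i : R => i.val) e)
        (K.submatrix e (fun i : R => i.val)) (K.submatrix e e) := by
    ext (i | i) (j | j) <;> rfl
  have hschur : K.submatrix e e - K.submatrix e (fun i : R => i.val) * ⅟A *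
      K.submatrix (fun i : R => i.val) e = (schurComplement K R).submatrix e e := by
    rw [Matrix.invOf_eq_nonsing_inv]
    rfl
  rw [principalMinor_eq_re_det_submatrix K hinj (S := S) (by simp [hS]), hblocks,
    Matrix.det_fromBlocks₁₁, hschur, hA, ← hK.ofReal_principalMinor, RCLike.re_ofReal_mul]

/-- After factoring out |K(S)|, this is Hadamard's inequality for a 2 × 2 block of the Schur
complement. -/
theorem Matrix.PosDef.principalMinor_local_submodular (hK : K.PosDef) (S : Finset (Fin n))
    (i j : Fin n) (hi : i ∉ S) (hj : j ∉ S) (hij : i ≠ j) :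
    principalMinor K (insert i (insert j S)) * principalMinor K S ≤
      principalMinor K (insert i S) * principalMinor K (insert j S) := by
  have hM := hK.isHermitian.schurComplement S
  set M := schurComplement K S with hMdef
  have single (a : Fin n) (ha : a ∉ S) :
      principalMinor K (insert a S) = principalMinor K S * RCLike.re (M a a) := by
    rw [hK.principalMinor_union_eq S (e := fun _ : Unit => a) (fun _ _ _ => rfl)
      (by intro x; simp [or_comm, eq_comm]) (fun _ => ha)]
    simp [hMdef]
  have pair : principalMinor K (insert i (insert j S)) =
      principalMinor K S * (RCLike.re (M i i) * RCLike.re (M j j) - ‖M i j‖ ^ 2) := by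
    rw [hK.principalMinor_union_eq S (e := ![i, j]) (S := insert i (insert j S))]
    · congr 1
      rw [← hMdef, Matrix.det_fin_two]
      have h1 : M j i = star (M i j) := (hM.apply j i).symm
      have h2 : (M i i : 𝕜) = (RCLike.re (M i i) : ℝ) := (hM.coe_re_apply_self i).symm
      have h3 : M i j * star (M i j) = ((‖M i j‖ ^ 2 : ℝ) : 𝕜) := by
        push_cast; exact RCLike.mul_conj _
      simp only [Matrix.submatrix_apply, Matrix.cons_val_zero, Matrix.cons_val_one]
      rw [h1, h3, map_sub, RCLike.ofReal_re, h2, RCLike.re_ofReal_mul, RCLike.ofReal_re]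
    · intro a b
      fin_cases a <;> fin_cases b <;> simp [hij, hij.symm]
    · intro x
      simp [Fin.exists_fin_two, eq_comm]
      tauto
    · intro a
      fin_cases a <;> simp [hi, hj]
  rw [single i hi, single j hj, pair]
  have : 0 ≤ principalMinor K S * principalMinor K S * ‖M i j‖ ^ 2 :=
    mul_nonneg (mul_self_nonneg _) (sq_nonneg _)
  nlinarith

theorem Matrix.PosDef.principalMinor_ratio_antitone (hK : K.PosDef) {S T : Finset (Fin n)}
    (hST : S ⊆ T) {i : Fin n} (hi : i ∉ T) :
    principalMinor K (insert i T) * principalMinor K S ≤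
      principalMinor K (insert i S) * principalMinor K T :=
  insert_mul_le_mul_insert_of_local hK.principalMinor_pos hK.principalMinor_local_submodular hST hi

/-- **Fischer's inequality**. -/
theorem Matrix.PosDef.principalMinor_union_le (hK : K.PosDef) {S T : Finset (Fin n)}
    (hST : Disjoint S T) : principalMinor K (S ∪ T) ≤ principalMinor K S * principalMinor K T := by
  simpa [principalMinor_empty] using union_mul_empty_le_of_antitone_ratio hK.principalMinor_pos
    (fun _ _ _ h hi => hK.principalMinor_ratio_antitone h hi) hST

theorem Matrix.PosDef.exists_schurComplement_eq_conjTranspose_mul_mul (hK : K.PosDef) (R : Finset (Fin n)) :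
    ∃ P : Matrix (Fin n) (Fin n) 𝕜, schurComplement K R = P.conjTranspose * K * P ∧
      ∀ i, i ∉ R → ∀ j, P i j = (1 : Matrix (Fin n) (Fin n) 𝕜) i j := by
  have hAu : IsUnit (K.submatrix (fun i : R => i.val) (fun i : R => i.val)).det :=
    (Matrix.isUnit_iff_isUnit_det _).1 (hK.submatrix Subtype.val_injective).isUnit
  set A := K.submatrix (fun i : R => i.val) (fun i : R => i.val) with hA
  set C := K.submatrix (fun i : R => i.val) id with hC
  have hCt : C.conjTranspose = K.submatrix id (fun i : R => i.val) := by
    rw [hC, Matrix.conjTranspose_submatrix, hK.isHermitian.eq]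
  set E : Matrix (Fin n) R 𝕜 := (1 : Matrix (Fin n) (Fin n) 𝕜).submatrix id (fun i : R => i.val)
    with hE
  have hEK : E.conjTranspose * K = C := by
    ext i j
    simp [hE, hC, Matrix.mul_apply, Matrix.one_apply]
  have hKE : K * E = C.conjTranspose := by
    rw [← hEK, Matrix.conjTranspose_mul, hK.isHermitian.eq, Matrix.conjTranspose_conjTranspose]
  have hCE : C * E = A := by
    ext i j
    simp [hE, hC, hA, Matrix.mul_apply, Matrix.one_apply]
  -- Block elimination of the columns: `E` includes the `R` coordinates, so rows outside `R` are
  -- unchanged, and E* K annihilates the witness, which kills the cross term.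
  refine ⟨1 - E * (A⁻¹ * C), ?_, fun i hi j => ?_⟩
  · have hS : schurComplement K R = K - C.conjTranspose * A⁻¹ * C := by
      rw [hCt]; rfl
    have h1 : K * (1 - E * (A⁻¹ * C)) = K - C.conjTranspose * (A⁻¹ * C) := by
      rw [Matrix.mul_sub, Matrix.mul_one, ← Matrix.mul_assoc, hKE]
    have h2 : E.conjTranspose * (K - C.conjTranspose * (A⁻¹ * C)) = 0 := by
      rw [← h1, ← Matrix.mul_assoc, hEK, Matrix.mul_sub, Matrix.mul_one, ← Matrix.mul_assoc, hCE,
        ← Matrix.mul_assoc, Matrix.mul_nonsing_inv _ hAu, Matrix.one_mul, sub_self]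
    rw [hS, Matrix.mul_assoc _ K, h1, Matrix.conjTranspose_sub, Matrix.sub_mul,
      Matrix.conjTranspose_mul, Matrix.mul_assoc _ E.conjTranspose, h2, Matrix.mul_zero, sub_zero,
      Matrix.conjTranspose_one, Matrix.one_mul, Matrix.mul_assoc]
  · have : ∀ a : R, E i a = 0 := fun a => by
      have hia : i ≠ a.val := fun h => hi (h ▸ a.2)
      exact Matrix.one_apply_ne hia
    simp [Matrix.mul_apply, this]

theorem Matrix.PosDef.principalMinor_mul_prod_incEigenvalues_le (hK : K.PosDef)
    {R T : Finset (Fin n)} (hRT : Disjoint R T) :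
    principalMinor K R * ∏ i ∈ idx n 1 T.card, incEigenvalues hK.isHermitian i ≤
      principalMinor K (R ∪ T) := by
  obtain ⟨P, hP, hP₁⟩ := hK.exists_schurComplement_eq_conjTranspose_mul_mul R
  have hT (i : T) : i.val ∉ R := fun h => Finset.disjoint_left.1 hRT h i.2
  rw [hK.principalMinor_union_eq R (S := R ∪ T) (e := fun i : T => i.val) Subtype.val_injective (by simp) hT]
  refine mul_le_mul_of_nonneg_left ?_ (hK.principalMinor_pos R).le
  set A : Matrix (Fin n) T 𝕜 := P.submatrix id (fun i : T => i.val) with hA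
  have hsub : (schurComplement K R).submatrix (fun i : T => i.val) (fun i : T => i.val) =
      A.conjTranspose * K * A := by
    rw [hP]; rfl
  have h1 : A.submatrix (fun i : T => i.val) id = 1 := by
    ext i j
    rw [Matrix.one_apply]
    simpa [hA, Matrix.one_apply, Subtype.val_inj] using hP₁ _ (hT i) j.val
  have hdet := Matrix.one_le_re_det_conjTranspose_mul_self A Subtype.val_injective h1
  have hmain := hK.prod_incEigenvalues_mul_det_le A
  rw [Fintype.card_coe] at hmain
  rw [hsub]
  refine le_trans (le_mul_of_one_le_right (Finset.prod_nonneg fun i _ =>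
    hK.incEigenvalues_nonneg i) hdet) hmain

end PrincipalMinor

/-! ### Assembling the inequality -/

theorem card_idx {n a b : ℕ} (hb : b ≤ n) : (idx n (a + 1) b).card = b - a := by
  rw [← Nat.card_Ico a b, ← Finset.card_map Fin.valEmbedding]
  congr 1
  ext x
  simp only [idx, Finset.mem_map, Finset.mem_filter, Finset.mem_univ, true_and, Finset.mem_Ico,
    Fin.valEmbedding_apply]
  constructor
  · rintro ⟨i, hi, rfl⟩
    omega
  · intro hx
    exact ⟨⟨x, by omega⟩, by simp; omega, rfl⟩

theorem theorem5 {𝕜 : Type*} [RCLike 𝕜] (n : ℕ) (K : Matrix (Fin n) (Fin n) 𝕜) (hK : K.PosDef)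
    (k h p l : ℕ) (hk : 1 ≤ k) (hkh : k ≤ h) (hhp : h ≤ p) (hpn : p ≤ n) (hl : l ≤ n - p) :
    ∏ i ∈ idx n 1 (h + l), incEigenvalues hK.isHermitian i ≤
      principalMinor K (idx n (p + 1) (p + l)) *
        (∏ S ∈ (idx n 1 h).powersetCard k,
          principalMinor K (S ∪ (idx n 1 p)ᶜ) / principalMinor K (idx n 1 p)ᶜ) ^
            (1 / ((h - 1).choose (k - 1) : ℝ)) := by
  set H := idx n 1 h
  set P := (idx n 1 p)ᶜ
  set Q := idx n (p + 1) (p + l)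
  have hcH : H.card = h := card_idx (a := 0) (by omega)
  have hcQ : Q.card = l := by rw [card_idx (by omega)]; omega
  have hHP : Disjoint H P := by
    rw [Finset.disjoint_left]
    simp [H, P, idx]
    omega
  have hQP : Q ⊆ P := by
    intro x
    simp [Q, P, idx]
    omega
  have hHQ : Disjoint H Q := hHP.mono_right hQP
  have hpos := hK.principalMinor_pos
  have han := le_prod_powersetCard_rpow_of_antitone_ratio
    (G := fun S => principalMinor K (S ∪ P) / principalMinor K P)
    (fun S => div_pos (hpos _) (hpos _)) (by simp [(hpos P).ne']) H
    (fun S T i hST hTH hi => by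
      have hiP : i ∉ P := Finset.disjoint_left.1 hHP (hTH (Finset.mem_insert_self i T))
      have := hK.principalMinor_ratio_antitone (i := i)
        (Finset.union_subset_union_left (t := P) hST) (by simp [hi, hiP])
      rw [← Finset.insert_union, ← Finset.insert_union] at this
      rw [div_mul_div_comm, div_mul_div_comm]
      exact div_le_div_of_nonneg_right this (mul_pos (hpos P) (hpos P)).le)
    hk (hcH.symm ▸ hkh)
  rw [hcH] at han
  refine le_trans ?_ (mul_le_mul_of_nonneg_left han (hpos Q).le)
  -- Moving `Q` from `P` to `H` leaves the union unchanged and makes the Schur complement of size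
  -- h+ℓ.
  have heig := hK.principalMinor_mul_prod_incEigenvalues_le (R := P \ Q) (T := H ∪ Q)
    (Finset.disjoint_union_right.2 ⟨hHP.symm.mono_left Finset.sdiff_subset, Finset.sdiff_disjoint⟩)
  rw [Finset.card_union_of_disjoint hHQ, hcH, hcQ, Finset.union_left_comm,
    Finset.sdiff_union_of_subset hQP] at heig
  have hfischer := hK.principalMinor_union_le (Finset.sdiff_disjoint (s := Q) (t := P))
  rw [Finset.sdiff_union_of_subset hQP] at hfischer
  rw [← mul_div_assoc, le_div_iff₀ (hpos P)]
  have hprod : 0 ≤ ∏ i ∈ idx n 1 (h + l), incEigenvalues hK.isHermitian i :=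
    Finset.prod_nonneg fun i _ => hK.incEigenvalues_nonneg i
  calc _ ≤ (∏ i ∈ idx n 1 (h + l), incEigenvalues hK.isHermitian i) *
        (principalMinor K (P \ Q) * principalMinor K Q) := mul_le_mul_of_nonneg_left hfischer hprod
    _ = principalMinor K Q * (principalMinor K (P \ Q) *
        ∏ i ∈ idx n 1 (h + l), incEigenvalues hK.isHermitian i) := by ring
    _ ≤ _ := mul_le_mul_of_nonneg_left heig (hpos Q).le
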